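/- **Definitions.** A graded poset is a finite poset $P$ with a minimum $\hat 0$, a maximum $\hat 1$ and a rank function $\rho:P\to\mathbb N$ with $\rho(\hat 0)=0$ and $\rho(y)-\rho(x)=1$ whenever $y$ covers $x$; its rank is $\rho(\hat 1)$. Let $n\ge 1$ and let $P$ have rank $n+1$. For $S\subseteq[1,n]=\{1,\dots,n\}$ let $f_S(P)$ be the number of chains in $P$ whose set of ranks is $S$. The flag vector of $P$ is $(f_S(P))_{S\subseteq[1,n]}\in\mathbb R^{2^n}$. For a positive integer $r$, a poset is $r$-thick if every nonempty open interval has at least $r$ elements. For real $k>0$ the $k$-Möbius function of a graded poset is defined by $\mu_k([x,x])=1$ and $\mu_k([x,y])=-1-\frac1k\sum_{x<z<y}\mu_k([x,z])$ for $x<y$. The poset is $k$-Eulerian if $\mu_k([x,y])=(-1)^{\rho(y)-\rho(x)}$ for all $x\le y$; half-Eulerian means $\tfrac12$-Eulerian. The closed cone of a set of vectors is the smallest closed convex cone in $\mathbb R^{2^n}$ containing it. Let $\mathcal C_{r,n+1}$ be the closed cone of the flag vectors of all $r$-thick graded posets of rank $n+1$. Let $DS_{k,n+1}\subseteq\mathbb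 R^{2^n}$ be the linear subspace of all $(x_S)_{S\subseteq[1,n]}$ satisfying $$k\left((-1)^{i-1}+(-1)^{\ell+1}\right)x_S+\sum_{j=i}^{\ell}(-1)^j x_{S\cup\{j\}}=0$$ for every $S\subseteq[1,n]$ and every maximal interval $[i,\ell]$ of $[1,n]\setminus S$. **Theorem.** Let $n$ be a positive integer. Suppose that the closed cone of the flag vectors of half-Eulerian graded posets of rank $n+1$ equals $\mathcal C_{1,n+1}\cap DS_{1/2,n+1}$. Then for every real $k\ge 1$ such that $2k$ is an integer, the closed cone of the flag vectors of $k$-Eulerian graded posets of rank $n+1$ equals $\mathcal C_{2k,n+1}\cap DS_{k,n+1}$. -/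

import Mathlib

/-!  Finite graded posets are modelled by Mathlib's classes: `PartialOrder P`, `BoundedOrder P`
(a minimum `⊥` and a maximum `⊤`), `Finite P` and `GradeMinOrder ℕ P` (a rank function
`grade ℕ : P → ℕ` with `grade ℕ ⊥ = 0`, raised by exactly one along every covering relation).
The rank of `P` is `grade ℕ ⊤`. -/

namespace FlagCone

/-- The rank in `[1, n]` represented by an index `i : Fin n`, namely `i + 1`.
Subsets of `[1, n]` are represented by `Finset (Fin n)`. -/
def rk {n : ℕ} (i : Fin n) : ℕ := (i : ℕ) + 1

/-- The space `ℝ^(2^n)`, with coordinates indexed by the subsets of `[1, n]`. -/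
abbrev FlagSpace (n : ℕ) : Type := Finset (Fin n) → ℝ

/-- `f_S(P)`: the number of chains of `P` whose set of ranks is exactly `S`. -/
noncomputable def flagNumber {n : ℕ} (P : Type*) [PartialOrder P] [GradeMinOrder ℕ P]
    (S : Finset (Fin n)) : ℕ :=
  {C : Set P | IsChain (· ≤ ·) C ∧ grade ℕ '' C = rk '' (S : Set (Fin n))}.ncard

/-- The flag vector `(f_S(P))`, `S ⊆ [1, n]`. -/
noncomputable def flagVector (n : ℕ) (P : Type*) [PartialOrder P] [GradeMinOrder ℕ P] :
    FlagSpace n :=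
  fun S => (flagNumber P S : ℝ)

/-- A poset is `r`-thick if every nonempty open interval has at least `r` elements. -/
def IsThick (r : ℕ) (P : Type*) [PartialOrder P] : Prop :=
  ∀ x y : P, (Set.Ioo x y).Nonempty → r ≤ (Set.Ioo x y).ncard

/-- The `k`-Möbius function `μ_k([x, y])`: it is `1` if `x = y`, and otherwise it is
`-1 - (1/k) ∑_{x < z < y} μ_k([x, z])`. (It is only used for `x ≤ y`; since `P` is finite, the
`finsum` is an ordinary finite sum.) -/
noncomputable def kMobius {P : Type*} [PartialOrder P] [Finite P] (k : ℝ) (x y : P) : ℝ :=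
  open Classical in
  if x = y then 1 else -1 - (1 / k) * ∑ᶠ z : Set.Ioo x y, kMobius k x z.1
termination_by (wellFounded_lt (α := P)).wrap y
decreasing_by exact z.2.2

/-- A graded poset is `k`-Eulerian if `μ_k([x, y]) = (-1)^ρ(x, y)` for every interval `[x, y]`,
where `ρ(x, y) = ρ(y) - ρ(x)`. -/
def IsKEulerian (k : ℝ) (P : Type*) [PartialOrder P] [Finite P] [GradeMinOrder ℕ P] : Prop :=
  ∀ x y : P, x ≤ y → kMobius k x y = (-1) ^ (grade ℕ y - grade ℕ x)

/-- The flag vectors of all `r`-thick graded posets of rank `n + 1`. -/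
def thickFlagVectors (r n : ℕ) : Set (FlagSpace n) :=
  {v | ∃ (P : Type) (_ : PartialOrder P) (_ : BoundedOrder P) (_ : Finite P)
    (_ : GradeMinOrder ℕ P),
    grade ℕ (⊤ : P) = n + 1 ∧ IsThick r P ∧ v = flagVector n P}

/-- The flag vectors of all `k`-Eulerian graded posets of rank `n + 1`. -/
def eulerianFlagVectors (k : ℝ) (n : ℕ) : Set (FlagSpace n) :=
  {v | ∃ (P : Type) (_ : PartialOrder P) (_ : BoundedOrder P) (_ : Finite P)
    (_ : GradeMinOrder ℕ P),
    grade ℕ (⊤ : P) = n + 1 ∧ IsKEulerian k P ∧ v = flagVector n P}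

/-- The smallest closed convex cone containing `V`. -/
noncomputable def closedCone {n : ℕ} (V : Set (FlagSpace n)) : PointedCone ℝ (FlagSpace n) :=
  (PointedCone.hull ℝ V).closure

/-- The cone `C_{r,n+1}`. -/
noncomputable def thickCone (r n : ℕ) : PointedCone ℝ (FlagSpace n) :=
  closedCone (thickFlagVectors r n)

/-- The closed cone of flag vectors of `k`-Eulerian posets of rank `n + 1`. -/
noncomputable def eulerianCone (k : ℝ) (n : ℕ) : PointedCone ℝ (FlagSpace n) :=
  closedCone (eulerianFlagVectors k n)

/-- `[i, l]` is a maximal interval of `[1, n] \ S`. -/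
def IsMaxGap {n : ℕ} (S : Finset (Fin n)) (i l : Fin n) : Prop :=
  i ≤ l ∧ Disjoint (Finset.Icc i l) S ∧
    ∀ i' l' : Fin n, i' ≤ i → l ≤ l' → Disjoint (Finset.Icc i' l') S → i' = i ∧ l' = l

/-- The subspace `DS_{k,n+1}` cut out by the generalized Dehn-Sommerville equations
`k((-1)^(i-1) + (-1)^(l+1)) x_S + ∑_{j=i}^{l} (-1)^j x_{S ∪ {j}} = 0`, one for each
`S ⊆ [1, n]` and each maximal interval `[i, l]` of `[1, n] \ S`. -/
noncomputable def dehnSommerville (k : ℝ) (n : ℕ) : Submodule ℝ (FlagSpace n) where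
  carrier := {x | ∀ (S : Finset (Fin n)) (i l : Fin n), IsMaxGap S i l →
    k * ((-1) ^ (rk i - 1) + (-1) ^ (rk l + 1)) * x S
      + ∑ j ∈ Finset.Icc i l, (-1) ^ rk j * x (S ∪ {j}) = 0}
  zero_mem' := by
    intro S i l _
    simp
  add_mem' := by
    intro a b ha hb S i l h
    have h1 := ha S i l h
    have h2 := hb S i l h
    simp only [Pi.add_apply, mul_add, Finset.sum_add_distrib] at h1 h2 ⊢
    linarith
  smul_mem' := by
    intro c a ha S i l h
    have h1 := ha S i l h
    have h2 : ∑ j ∈ Finset.Icc i l, (-1 : ℝ) ^ rk j * (c • a) (S ∪ {j})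
        = c * ∑ j ∈ Finset.Icc i l, (-1 : ℝ) ^ rk j * a (S ∪ {j}) := by
      rw [Finset.mul_sum]
      refine Finset.sum_congr rfl fun j _ => ?_
      simp only [Pi.smul_apply, smul_eq_mul]
      ring
    rw [h2]
    simp only [Pi.smul_apply, smul_eq_mul]
    linear_combination c * h1

end FlagCone

/-! ### Euler relations in intervals and thickness -/

namespace FlagCone
open Finset
-- Put r = 2k. For the inclusion from left to right, the Euler relation in a rank-2 interval says
-- that it has exactly r middle elements, which gives r-thickness (`IsKEulerian.isThick`). Sorting
-- the Euler relation by rank, and summing it over all chains with rank set S, gives the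
-- Dehn-Sommerville equations (`IsKEulerian.flagVector_mem_dehnSommerville`).
--
-- For the converse, use the linear maps x_S ↦ t^|S| x_S. With t = 1/r such a map carries DS_k to
-- DS_{1/2}. With t = r it carries the half-Eulerian cone into the k-Eulerian one, being realized by
-- replacing each proper element with r copies (`Blowup`). It remains that t = 1/r carries the
-- r-thick cone into C_1.
--
-- This last fact is a count of maximal chains (`IsThick.scale_flagVector_mem`). In an r-thick poset
-- a chain with rank set S can be completed from the bottom up with exactly r permitted choices at
-- each missing rank, so r^(n-|S|) f_S counts the maximal chains that are good for S. Whether a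
-- fixed maximal chain is good depends on S only through the condition that S meets every interval
-- of a family attached to the chain. Hence r^(-|S|) f_S is a nonnegative combination of indicators
-- of such conditions, and each indicator is a limit of scaled flag vectors of explicit posets
-- (`IntervalPoset`).
open scoped Classical in
theorem kMobius_of_lt {P : Type*} [PartialOrder P] [Fintype P] (k : ℝ) {x y : P} (h : x < y) :
    kMobius k x y = -1 - (1 / k) * ∑ z with x < z ∧ z < y, kMobius k x z := by
  rw [kMobius, if_neg h.ne, finsum_eq_sum_of_fintype]
  congr 2
  refine Finset.sum_bij (fun z _ => z.1) ?_ ?_ ?_ ?_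
  · intro z _
    rw [mem_filter_univ]
    exact z.2
  · intro a _ b _ hab
    exact Subtype.ext hab
  · intro b hb
    exact ⟨⟨b, by simpa using hb⟩, mem_univ _, rfl⟩
  · intros; rfl

theorem kMobius_self {P : Type*} [PartialOrder P] [Finite P] (k : ℝ) (x : P) :
    kMobius k x x = 1 := by
  rw [kMobius, if_pos rfl]

-- Substituting the prescribed values ±1 into the recursion, by induction on the upper end, removes
-- `kMobius` and leaves one alternating-sum identity per interval.
open scoped Classical in
theorem isKEulerian_iff {P : Type*} [PartialOrder P] [Fintype P] [GradeMinOrder ℕ P] {k : ℝ}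
    (hk : k ≠ 0) :
    IsKEulerian k P ↔ ∀ x y : P, x < y →
      ∑ z with x < z ∧ z < y, (-1 : ℝ) ^ (grade ℕ z - grade ℕ x)
        = -k * (1 + (-1) ^ (grade ℕ y - grade ℕ x)) := by
  constructor
  · intro h x y hxy
    have h1 := h x y hxy.le
    rw [kMobius_of_lt k hxy, sum_congr rfl fun z hz => h x z (by simp at hz; exact hz.1.le)] at h1
    rw [← h1]
    field_simp
    ring
  · intro h x y
    induction y using (wellFounded_lt (α := P)).induction with
    | _ y ih =>
    intro hxy
    rcases hxy.eq_or_lt with rfl | hlt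
    · simp [kMobius_self]
    · rw [kMobius_of_lt k hlt, sum_congr rfl fun z hz => ih z (by simp at hz; exact hz.2)
        (by simp at hz; exact hz.1.le), h x y hlt]
      field_simp
      ring

theorem grade_eq_of_covBy {P : Type*} [PartialOrder P] [GradeMinOrder ℕ P] {x y : P}
    (h : x ⋖ y) : grade ℕ y = grade ℕ x + 1 := by
  have := h.grade ℕ
  exact (Nat.covBy_iff_add_one_eq.1 this).symm

theorem exists_covBy_covBy {P : Type*} [PartialOrder P] [Finite P] [GradeMinOrder ℕ P]
    {x y : P} (h : x < y) (hg : grade ℕ x + 1 < grade ℕ y) :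
    ∃ z w : P, x ⋖ z ∧ z ⋖ w ∧ w ≤ y := by
  obtain ⟨z, hz, hzy⟩ := exists_covBy_le_of_lt h
  have hzy' : z < y := by
    refine hzy.lt_of_ne ?_
    rintro rfl
    have := grade_eq_of_covBy hz
    omega
  obtain ⟨w, hw, hwy⟩ := exists_covBy_le_of_lt hzy'
  exact ⟨z, w, hz, hw, hwy⟩

theorem grade_lt {P : Type*} [PartialOrder P] [GradeMinOrder ℕ P] {x y : P} (h : x < y) :
    grade ℕ x < grade ℕ y := grade_strictMono h

/-- In a rank-2 interval every middle element contributes -1 to the Euler relation, so there are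
exactly 2k of them; every nonempty open interval contains such a middle level. -/
theorem IsKEulerian.isThick {P : Type*} [PartialOrder P] [Finite P] [GradeMinOrder ℕ P] {k : ℝ}
    (hk : k ≠ 0) {r : ℕ} (hr : 2 * k = r) (h : IsKEulerian k P) : IsThick r P := by
  classical
  have := Fintype.ofFinite P
  rintro x y ⟨u, hxu, huy⟩
  obtain ⟨z, w, hz, hw, hwy⟩ := exists_covBy_covBy (hxu.trans huy)
    (by have := grade_lt hxu; have := grade_lt huy; omega)
  have hxw : x < w := hz.lt.trans hw.lt
  have hgw : grade ℕ w = grade ℕ x + 2 := by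
    rw [grade_eq_of_covBy hw, grade_eq_of_covBy hz]
  have h1 := (isKEulerian_iff hk).1 h x w hxw
  rw [sum_congr rfl (g := fun _ => (-1 : ℝ)), hgw] at h1
  · have h2 : (#{z : P | x < z ∧ z < w} : ℝ) = r := by
      simp only [sum_const, nsmul_eq_mul, Nat.add_sub_cancel_left] at h1
      rw [← hr]; norm_num at h1; linarith
    have h3 : (Set.Ioo x w).ncard = r := by
      rw [← Nat.cast_inj (R := ℝ), ← h2, Set.ncard_eq_toFinset_card']
      congr 2
      ext z; simp
    rw [← h3]
    exact Set.ncard_le_ncard (Set.Ioo_subset_Ioo_right hwy) (Set.toFinite _)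
  · intro z hz
    simp only [mem_filter_univ] at hz
    have := grade_lt hz.1
    have := grade_lt hz.2
    rw [show grade ℕ z - grade ℕ x = 1 by omega, pow_one]

/-! ### Flags as functions -/

/-- `c` lists the elements of a chain with rank set `S`, and takes the value `⊥` off `S`. -/
def IsFlag {n : ℕ} {P : Type*} [PartialOrder P] [OrderBot P] [GradeMinOrder ℕ P]
    (S : Finset (Fin n)) (c : Fin n → P) : Prop :=
  (∀ i ∈ S, grade ℕ (c i) = rk i) ∧ (∀ i ∈ S, ∀ j ∈ S, i < j → c i < c j) ∧ ∀ i ∉ S, c i = ⊥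

open scoped Classical in
/-- The chains with rank set `S`, as functions. -/
noncomputable def flags {n : ℕ} (P : Type*) [PartialOrder P] [OrderBot P] [Fintype P]
    [GradeMinOrder ℕ P] (S : Finset (Fin n)) : Finset (Fin n → P) :=
  {c | IsFlag S c}

variable {n : ℕ} {P : Type*} [PartialOrder P] [Fintype P] [GradeMinOrder ℕ P]

theorem mem_flags [OrderBot P] {S : Finset (Fin n)} {c : Fin n → P} :
    c ∈ flags P S ↔ IsFlag S c := by
  simp [flags]

/-- A chain has at most one element of each rank, so it can be listed by rank; the fixed value `⊥`
off S makes the listing unique. -/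
theorem flagNumber_eq_card_flags [OrderBot P] (S : Finset (Fin n)) :
    flagNumber P S = #(flags P S) := by
  classical
  have hinj : ∀ {i j : Fin n}, rk i = rk j → i = j := by
    intro i j h; simp only [rk] at h; exact Fin.ext (by omega)
  rw [flagNumber, ← Set.ncard_coe_finset]
  have him : {C : Set P | IsChain (· ≤ ·) C ∧ grade ℕ '' C = rk '' (S : Set (Fin n))}
      = (fun c : Fin n → P => c '' (S : Set (Fin n))) '' (flags P S : Set (Fin n → P)) := by
    ext C
    constructor
    · rintro ⟨hC, hg⟩
      have hmono : ∀ x ∈ C, ∀ y ∈ C, grade ℕ x < grade ℕ y → x < y := by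
        intro x hx y hy hxy
        have hne : x ≠ y := by rintro rfl; exact hxy.false
        rcases hC hx hy hne with h | h
        · exact h.lt_of_ne hne
        · exact absurd (grade_mono h) (not_le.2 hxy)
      have hex : ∀ i : Fin n, ∃ x : P, (i ∈ S → x ∈ C ∧ grade ℕ x = rk i) ∧ (i ∉ S → x = ⊥) := by
        intro i
        by_cases hi : i ∈ S
        · have : rk i ∈ grade ℕ '' C := by rw [hg]; exact ⟨i, hi, rfl⟩
          obtain ⟨x, hx, hxi⟩ := this
          exact ⟨x, fun _ => ⟨hx, hxi⟩, fun h => absurd hi h⟩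
        · exact ⟨⊥, fun h => absurd h hi, fun _ => rfl⟩
      choose c hc hc' using hex
      refine ⟨c, ?_, ?_⟩
      · rw [mem_coe, mem_flags]
        refine ⟨fun i hi => (hc i hi).2, fun i hi j hj hij => ?_, hc'⟩
        refine hmono _ (hc i hi).1 _ (hc j hj).1 ?_
        rw [(hc i hi).2, (hc j hj).2]
        simpa [rk] using hij
      · ext x
        constructor
        · rintro ⟨i, hi, rfl⟩
          exact (hc i hi).1
        · intro hx
          have : grade ℕ x ∈ rk '' (S : Set (Fin n)) := by rw [← hg]; exact ⟨x, hx, rfl⟩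
          obtain ⟨i, hi, hix⟩ := this
          refine ⟨i, hi, ?_⟩
          by_contra hne
          have h1 := hc i hi
          rcases hC h1.1 hx hne with h | h
          · have := grade_lt (h.lt_of_ne hne); omega
          · have := grade_lt (h.lt_of_ne (Ne.symm hne)); omega
    · rintro ⟨c, hc, rfl⟩
      rw [mem_coe, mem_flags] at hc
      refine ⟨?_, ?_⟩
      · rintro _ ⟨i, hi, rfl⟩ _ ⟨j, hj, rfl⟩ hne
        rcases lt_trichotomy i j with h | rfl | h
        · exact Or.inl (hc.2.1 i hi j hj h).le
        · exact absurd rfl hne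
        · exact Or.inr (hc.2.1 j hj i hi h).le
      · rw [Set.image_image]
        exact Set.image_congr fun i hi => hc.1 i hi
  rw [him]
  refine Set.InjOn.ncard_image ?_
  intro c hc d hd hcd
  rw [mem_coe, mem_flags] at hc hd
  funext i
  by_cases hi : i ∈ S
  · have : c i ∈ d '' (S : Set (Fin n)) := by
      have h2 : c '' (S : Set (Fin n)) = d '' (S : Set (Fin n)) := hcd
      rw [← h2]; exact ⟨i, hi, rfl⟩
    obtain ⟨j, hj, hji⟩ := this
    have h1 := hc.1 i hi
    rw [← hji, hd.1 j hj] at h1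
    rw [← hji, hinj h1]
  · rw [hc.2.2 i hi, hd.2.2 i hi]

/-! ### Inserting an element into a flag -/

open scoped Classical in
/-- The elements of the rank indexed by `j` that are comparable with the elements of `c` at `S`. -/
noncomputable def fillers [OrderBot P] (S : Finset (Fin n)) (c : Fin n → P) (j : Fin n) :
    Finset P :=
  {z | grade ℕ z = rk j ∧ ∀ m ∈ S, (m < j → c m < z) ∧ (j < m → z < c m)}

theorem mem_fillers [OrderBot P] {S : Finset (Fin n)} {c : Fin n → P} {j : Fin n} {z : P} :
    z ∈ fillers S c j ↔
      grade ℕ z = rk j ∧ ∀ m ∈ S, (m < j → c m < z) ∧ (j < m → z < c m) := by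
  simp [fillers]

theorem IsFlag.update [OrderBot P] {S : Finset (Fin n)} {c : Fin n → P} {j : Fin n} (hj : j ∉ S)
    (hc : IsFlag S c) {z : P} (hz : z ∈ fillers S c j) :
    IsFlag (insert j S) (Function.update c j z) := by
  rw [mem_fillers] at hz
  refine ⟨?_, ?_, ?_⟩
  · intro i hi
    rcases eq_or_ne i j with rfl | hij
    · simpa using hz.1
    · rw [Function.update_of_ne hij]
      exact hc.1 i (by simpa [hij] using hi)
  · intro i hi m hm him
    rcases eq_or_ne i j with rfl | hij
    · rw [Function.update_self, Function.update_of_ne him.ne']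
      exact (hz.2 m (by simpa [him.ne'] using hm)).2 him
    · rw [Function.update_of_ne hij]
      rcases eq_or_ne m j with rfl | hmj
      · rw [Function.update_self]
        exact (hz.2 i (by simpa [hij] using hi)).1 him
      · rw [Function.update_of_ne hmj]
        exact hc.2.1 i (by simpa [hij] using hi) m (by simpa [hmj] using hm) him
  · intro i hi
    simp only [mem_insert, not_or] at hi
    rw [Function.update_of_ne hi.1]
    exact hc.2.2 i hi.2

theorem IsFlag.erase [OrderBot P] {S : Finset (Fin n)} {c : Fin n → P} {j : Fin n} (hj : j ∉ S)
    (hc : IsFlag (insert j S) c) :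
    IsFlag S (Function.update c j ⊥) ∧ c j ∈ fillers S (Function.update c j ⊥) j := by
  have hne : ∀ i ∈ S, i ≠ j := by rintro i hi rfl; exact hj hi
  refine ⟨⟨?_, ?_, ?_⟩, ?_⟩
  · intro i hi
    rw [Function.update_of_ne (hne i hi)]
    exact hc.1 i (mem_insert_of_mem hi)
  · intro i hi m hm him
    rw [Function.update_of_ne (hne i hi), Function.update_of_ne (hne m hm)]
    exact hc.2.1 i (mem_insert_of_mem hi) m (mem_insert_of_mem hm) him
  · intro i hi
    rcases eq_or_ne i j with rfl | hij
    · simp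
    · rw [Function.update_of_ne hij]
      exact hc.2.2 i (by simp [hij, hi])
  · rw [mem_fillers]
    refine ⟨hc.1 j (mem_insert_self _ _), fun m hm => ?_⟩
    rw [Function.update_of_ne (hne m hm)]
    exact ⟨fun h => hc.2.1 m (mem_insert_of_mem hm) j (mem_insert_self _ _) h,
      fun h => hc.2.1 j (mem_insert_self _ _) m (mem_insert_of_mem hm) h⟩

/-- Counting flags by restriction, with the inserted element confined to a set `A c`. -/
theorem card_insert_flags {P : Type*} [PartialOrder P] [GradeMinOrder ℕ P] [OrderBot P]
    {S : Finset (Fin n)} {j : Fin n} (hj : j ∉ S)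
    (G G' : Finset (Fin n → P)) (A : (Fin n → P) → Finset P)
    (hG : ∀ c ∈ G, IsFlag S c)
    (hG' : ∀ c, c ∈ G' ↔ Function.update c j ⊥ ∈ G ∧ c j ∈ A (Function.update c j ⊥)) :
    #G' = ∑ c ∈ G, #(A c) := by
  classical
  rw [← card_sigma]
  refine card_nbij' (fun c => ⟨Function.update c j ⊥, c j⟩) (fun p => Function.update p.1 j p.2)
    ?_ ?_ ?_ ?_
  · intro c hc
    simpa using (hG' c).1 hc
  · rintro ⟨c, z⟩ h
    simp only [mem_coe, mem_sigma] at h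
    have h0 : Function.update c j ⊥ = c := by
      rw [← (hG c h.1).2.2 j hj, Function.update_eq_self]
    simp only [mem_coe]
    rw [hG']
    simpa [h0] using h
  · intro c _
    simp
  · rintro ⟨c, z⟩ h
    simp only [mem_coe, mem_sigma] at h
    have h0 : Function.update c j ⊥ = c := by
      rw [← (hG c h.1).2.2 j hj, Function.update_eq_self]
    simp [h0]

theorem card_flags_insert [OrderBot P] {S : Finset (Fin n)} {j : Fin n} (hj : j ∉ S) :
    #(flags P (insert j S)) = ∑ c ∈ flags P S, #(fillers S c j) := by
  refine card_insert_flags hj _ _ _ (fun c hc => mem_flags.1 hc) fun c => ?_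
  rw [mem_flags, mem_flags]
  refine ⟨fun h => h.erase hj, fun h => ?_⟩
  have := h.1.update hj h.2
  simpa using this

/-- Between the two ends of a maximal gap, the fillers of a flag form an open interval. -/
theorem IsFlag.exists_gap_ends [BoundedOrder P] (hP : grade ℕ (⊤ : P) = n + 1)
    {S : Finset (Fin n)} {c : Fin n → P} (hc : IsFlag S c) {i l : Fin n} (h : IsMaxGap S i l) :
    ∃ x y : P, x < y ∧ grade ℕ x = i ∧ grade ℕ y = l + 2 ∧
      ∀ j ∈ Icc i l, ∀ z : P, grade ℕ z = rk j → (z ∈ fillers S c j ↔ x < z ∧ z < y) := by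
  classical
  obtain ⟨hil, hd, hmax⟩ := h
  -- The lower end is the flag element at index i - 1, which has rank i and must exist by maximality
  -- of the gap, or `⊥` when i = 0. It is the tightest constraint from below; `hup` is the dual,
  -- with `⊤` of rank n + 1 as fallback.
  have hlow : ∃ x : P, grade ℕ x = i ∧ (∀ y : P, i < grade ℕ y → (∀ m ∈ S, m < i → c m < y) →
      x < y) ∧ ∀ m ∈ S, m < i → c m ≤ x := by
    rcases Nat.eq_zero_or_pos (i : ℕ) with h0 | h0
    · refine ⟨⊥, by simp [h0], fun y hy _ => bot_lt_iff_ne_bot.2 ?_, fun m _ hm => ?_⟩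
      · rintro rfl
        simp at hy
      · exact absurd (Fin.lt_def.1 hm) (by omega)
    · let i' : Fin n := ⟨i - 1, by omega⟩
      have hi' : i' < i := Fin.lt_def.2 (by simp [i']; omega)
      have hmem : i' ∈ S := by
        by_contra hni
        refine hi'.ne (hmax i' l hi'.le le_rfl ?_).1
        rw [Finset.disjoint_left]
        intro a ha
        rw [mem_Icc, Fin.le_def] at ha
        rcases eq_or_ne a i' with rfl | hne
        · exact hni
        · refine Finset.disjoint_left.1 hd (mem_Icc.2 ⟨Fin.le_def.2 ?_, ha.2⟩)
          have : (a : ℕ) ≠ i' := fun h => hne (Fin.ext h)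
          simp only [i'] at this ha ⊢
          omega
      refine ⟨c i', ?_, fun y _ hy => hy _ hmem hi', fun m hm hmi => ?_⟩
      · rw [hc.1 _ hmem]; simp [rk, i']; omega
      · rcases eq_or_ne m i' with rfl | hne
        · exact le_rfl
        · refine (hc.2.1 m hm i' hmem (Fin.lt_def.2 ?_)).le
          have : (m : ℕ) ≠ i' := fun h => hne (Fin.ext h)
          have := Fin.lt_def.1 hmi
          simp only [i'] at *
          omega
  have hup : ∃ y : P, grade ℕ y = l + 2 ∧ (∀ x : P, grade ℕ x < l + 2 →
      (∀ m ∈ S, l < m → x < c m) → x < y) ∧ ∀ m ∈ S, l < m → y ≤ c m := by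
    rcases Nat.lt_or_ge (l + 1 : ℕ) n with h0 | h0
    · let l' : Fin n := ⟨l + 1, h0⟩
      have hl' : l < l' := Fin.lt_def.2 (by simp [l'])
      have hmem : l' ∈ S := by
        by_contra hni
        refine hl'.ne' (hmax i l' le_rfl hl'.le ?_).2
        rw [Finset.disjoint_left]
        intro a ha
        rw [mem_Icc, Fin.le_def, Fin.le_def] at ha
        rcases eq_or_ne a l' with rfl | hne
        · exact hni
        · refine Finset.disjoint_left.1 hd (mem_Icc.2 ⟨ha.1, Fin.le_def.2 ?_⟩)
          have : (a : ℕ) ≠ l' := fun h => hne (Fin.ext h)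
          simp only [l'] at this ha ⊢
          omega
      refine ⟨c l', ?_, fun y _ hy => hy _ hmem hl', fun m hm hmi => ?_⟩
      · rw [hc.1 _ hmem]; simp [rk, l']
      · rcases eq_or_ne m l' with rfl | hne
        · exact le_rfl
        · refine (hc.2.1 l' hmem m hm (Fin.lt_def.2 ?_)).le
          have : (m : ℕ) ≠ l' := fun h => hne (Fin.ext h)
          have := Fin.lt_def.1 hmi
          simp only [l'] at *
          omega
    · refine ⟨⊤, by rw [hP]; omega, fun y hy _ => lt_top_iff_ne_top.2 ?_, fun m _ hm => ?_⟩
      · rintro rfl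
        omega
      · exact absurd (Fin.lt_def.1 hm) (by omega)
  obtain ⟨x, hx, hx1, hx2⟩ := hlow
  obtain ⟨y, hy, hy1, hy2⟩ := hup
  have hil' := Fin.le_def.1 hil
  have hnot : ∀ m ∈ S, ¬ (i ≤ m ∧ m ≤ l) := fun m hm hh =>
    Finset.disjoint_left.1 hd (mem_Icc.2 hh) hm
  refine ⟨x, y, ?_, hx, hy, ?_⟩
  · refine hx1 y (by omega) fun m hm hmi => hy1 _ ?_ fun m' hm' hlm' => ?_
    · rw [hc.1 m hm]; have := Fin.lt_def.1 hmi; simp [rk]; omega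
    · exact hc.2.1 m hm m' hm' (hmi.trans (hil.trans_lt hlm'))
  · intro j hj z hz
    rw [mem_Icc] at hj
    have hj1 := Fin.le_def.1 hj.1
    have hj2 := Fin.le_def.1 hj.2
    simp only [rk] at hz
    rw [mem_fillers]
    constructor
    · rintro ⟨-, h⟩
      exact ⟨hx1 z (by omega) fun m hm hmi => (h m hm).1 (hmi.trans_le hj.1),
        hy1 z (by omega) fun m hm hmi => (h m hm).2 (hj.2.trans_lt hmi)⟩
    · rintro ⟨h1, h2⟩
      refine ⟨hz, fun m hm => ⟨fun hmj => ?_, fun hmj => ?_⟩⟩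
      · refine (hx2 m hm ?_).trans_lt h1
        by_contra hcon
        exact hnot m hm ⟨not_lt.1 hcon, hmj.le.trans hj.2⟩
      · refine h2.trans_le (hy2 m hm ?_)
        by_contra hcon
        exact hnot m hm ⟨hj.1.trans hmj.le, not_lt.1 hcon⟩

/-! ### The Dehn-Sommerville equations -/

/-- The equation already holds flag by flag: for a fixed flag on S the fillers over the gap form an
open interval, and the Euler relation there, sorted by rank, is the summand. -/
theorem IsKEulerian.flagVector_mem_dehnSommerville [BoundedOrder P]
    (hP : grade ℕ (⊤ : P) = n + 1) {k : ℝ} (hk : k ≠ 0) (h : IsKEulerian k P) :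
    flagVector n P ∈ dehnSommerville k n := by
  classical
  intro S i l hgap
  have hins : ∀ j ∈ Icc i l, flagVector n P (S ∪ {j}) = ∑ c ∈ flags P S, (#(fillers S c j) : ℝ) := by
    intro j hj
    have hjS : j ∉ S := Finset.disjoint_left.1 hgap.2.1 hj
    rw [union_comm, ← insert_eq, flagVector, flagNumber_eq_card_flags, card_flags_insert hjS]
    push_cast
    rfl
  rw [sum_congr rfl fun j hj => by rw [hins j hj, mul_sum], sum_comm, flagVector,
    flagNumber_eq_card_flags, card_eq_sum_ones]
  push_cast
  rw [mul_sum, ← sum_add_distrib]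
  refine sum_eq_zero fun c hc => ?_
  obtain ⟨x, y, hxy, hx, hy, hz⟩ := (mem_flags.1 hc).exists_gap_ends hP hgap
  have h1 := (isKEulerian_iff hk).1 h x y hxy
  have hil := Fin.le_def.1 hgap.1
  have h2 : ∑ j ∈ Icc i l, (-1 : ℝ) ^ rk j * #(fillers S c j)
      = (-1) ^ (i : ℕ) * ∑ z with x < z ∧ z < y, (-1 : ℝ) ^ (grade ℕ z - grade ℕ x) := by
    -- The minimum with n - 1 only serves to produce an element of `Fin n`; it is inactive here,
    -- since the rank of z lies between i + 1 and l + 1.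
    have hmaps : ∀ z ∈ (univ.filter fun z : P => x < z ∧ z < y),
        (⟨min (grade ℕ z - 1) (n - 1), by have := i.2; omega⟩ : Fin n) ∈ Icc i l := by
      intro z hz
      simp only [mem_filter_univ] at hz
      have h3 := grade_lt hz.1
      have h4 := grade_lt hz.2
      have := l.2
      rw [mem_Icc, Fin.le_def, Fin.le_def]
      simp only
      omega
    rw [← sum_fiberwise_of_maps_to hmaps, mul_sum]
    refine sum_congr rfl fun j hj => ?_
    have hj' := mem_Icc.1 hj
    have hj1 := Fin.le_def.1 hj'.1
    have hfil : fillers S c j = ((univ.filter fun z : P => x < z ∧ z < y).filter fun z =>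
        (⟨min (grade ℕ z - 1) (n - 1), by have := i.2; omega⟩ : Fin n) = j) := by
      ext z
      simp only [mem_filter, mem_univ, true_and]
      constructor
      · intro hzf
        have hg : grade ℕ z = rk j := (mem_fillers.1 hzf).1
        refine ⟨(hz j hj z hg).1 hzf, Fin.ext ?_⟩
        have := j.2
        simp only [rk] at hg ⊢
        omega
      · rintro ⟨hzxy, hzj⟩
        have h3 := grade_lt hzxy.1
        have h4 := grade_lt hzxy.2
        have h5 := congrArg Fin.val hzj
        simp only at h5
        have := l.2
        refine (hz j hj z ?_).2 hzxy
        simp only [rk]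
        omega
    rw [hfil, sum_congr rfl (g := fun _ => (-1 : ℝ) ^ (rk j - i)), sum_const, nsmul_eq_mul,
      mul_left_comm, ← pow_add, mul_comm]
    · congr 2
      simp only [rk]; omega
    · intro z hzz
      rw [← hfil] at hzz
      rw [(mem_fillers.1 hzz).1, hx]
  rw [h2, h1, hx, hy]
  simp only [rk]
  obtain ⟨d, hd⟩ := Nat.exists_eq_add_of_le hil
  rw [hd, show (i : ℕ) + d + 2 - i = d + 2 by omega]
  simp only [Nat.add_sub_cancel, pow_add]
  have : ((-1 : ℝ) ^ (i : ℕ)) * (-1) ^ (i : ℕ) = 1 := by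
    rw [← mul_pow]; norm_num
  norm_num
  ring
end FlagCone

namespace FlagCone
open Finset

/-! ### Replacing every proper element by `r` copies -/

/-- The poset obtained from `P` by replacing every element other than `⊥` and `⊤` by `r`
incomparable copies. -/
def Blowup (r : ℕ) (P : Type*) [PartialOrder P] [BoundedOrder P] [NeZero r] : Type _ :=
  {p : P × Fin r // p.1 = ⊥ ∨ p.1 = ⊤ → p.2 = 0}

namespace Blowup
variable {r : ℕ} [NeZero r] {P : Type*} [PartialOrder P] [BoundedOrder P]

/-- The element of `P` of which `p` is a copy. -/
def base (p : Blowup r P) : P := p.1.1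

/-- The index of the copy. -/
def copy (p : Blowup r P) : Fin r := p.1.2

theorem ext {p q : Blowup r P} (h : p.base = q.base) (h' : p.copy = q.copy) : p = q :=
  Subtype.ext (Prod.ext h h')

open scoped Classical in
/-- The copy of `x` with index `e`, or the only copy if `x` is `⊥` or `⊤`. -/
noncomputable def mk (x : P) (e : Fin r) : Blowup r P :=
  ⟨(x, if x = ⊥ ∨ x = ⊤ then 0 else e), fun h => by simp only at h; simp [h]⟩

theorem base_mk (x : P) (e : Fin r) : (mk x e).base = x := rfl

theorem copy_mk {x : P} (h : x ≠ ⊥) (h' : x ≠ ⊤) (e : Fin r) : (mk x e).copy = e := by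
  simp [mk, copy, h, h']

theorem mk_base_copy (p : Blowup r P) : mk p.base p.copy = p := by
  refine ext rfl ?_
  by_cases h : p.base = ⊥ ∨ p.base = ⊤
  · simp only [mk, copy, if_pos h]
    exact (p.2 h).symm
  · push Not at h
    exact copy_mk h.1 h.2 _

theorem eq_of_base_eq {p q : Blowup r P} (h : p.base = q.base) (h' : p.base = ⊥ ∨ p.base = ⊤) :
    p = q :=
  ext h ((p.2 h').trans (q.2 (by rw [← base, ← h]; exact h')).symm)

instance : PartialOrder (Blowup r P) where
  le p q := p = q ∨ p.base < q.base
  le_refl p := Or.inl rfl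
  le_trans p q s := by
    rintro (rfl | h) (rfl | h')
    exacts [Or.inl rfl, Or.inr h', Or.inr h, Or.inr (h.trans h')]
  le_antisymm p q := by
    rintro (rfl | h) (h' | h')
    exacts [rfl, rfl, h'.symm, absurd (h.trans h') (lt_irrefl _)]

theorem le_iff {p q : Blowup r P} : p ≤ q ↔ p = q ∨ p.base < q.base := Iff.rfl

theorem lt_iff {p q : Blowup r P} : p < q ↔ p.base < q.base := by
  rw [lt_iff_le_and_ne, le_iff]
  constructor
  · rintro ⟨rfl | h, h'⟩
    exacts [absurd rfl h', h]
  · intro h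
    refine ⟨Or.inr h, ?_⟩
    rintro rfl
    exact h.false

noncomputable instance : BoundedOrder (Blowup r P) where
  top := mk ⊤ 0
  le_top p := by
    rw [le_iff]
    by_cases h : p.base = ⊤
    · exact Or.inl (eq_of_base_eq h (Or.inr h))
    · exact Or.inr (lt_top_iff_ne_top.2 h)
  bot := mk ⊥ 0
  bot_le p := by
    rw [le_iff]
    by_cases h : p.base = ⊥
    · exact Or.inl (eq_of_base_eq h (Or.inl h)).symm
    · exact Or.inr (bot_lt_iff_ne_bot.2 h)

theorem base_bot : (⊥ : Blowup r P).base = ⊥ := rfl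

theorem base_top : (⊤ : Blowup r P).base = ⊤ := rfl

theorem covBy_iff {p q : Blowup r P} : p ⋖ q ↔ p.base ⋖ q.base := by
  constructor
  · rintro ⟨h, h'⟩
    refine ⟨lt_iff.1 h, fun x hx hxq => h' (c := mk x 0) (lt_iff.2 hx) (lt_iff.2 hxq)⟩
  · rintro ⟨h, h'⟩
    exact ⟨lt_iff.2 h, fun x hx hxq => h' (lt_iff.1 hx) (lt_iff.1 hxq)⟩

instance [GradeMinOrder ℕ P] : GradeMinOrder ℕ (Blowup r P) where
  grade p := grade ℕ p.base
  grade_strictMono p q h := grade_lt (lt_iff.1 h)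
  covBy_grade p q h := (covBy_iff.1 h).grade ℕ
  isMin_grade p h := by
    have : p = ⊥ := isMin_iff_eq_bot.1 h
    subst this
    rw [base_bot, grade_bot]
    exact isMin_bot

theorem grade_eq [GradeMinOrder ℕ P] (p : Blowup r P) : grade ℕ p = grade ℕ p.base := rfl

noncomputable instance [Fintype P] : Fintype (Blowup r P) := by
  classical
  unfold Blowup
  infer_instance

/-- Elements of an open interval are never `⊥` or `⊤`, so each term of the Euler sum occurs exactly
r times. -/
theorem isKEulerian [Fintype P] [GradeMinOrder ℕ P] {k l : ℝ} (hk : k ≠ 0) (hl : l ≠ 0)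
    (hr : l * r = k) (h : IsKEulerian l P) : IsKEulerian k (Blowup r P) := by
  classical
  rw [isKEulerian_iff hk]
  intro p q hpq
  have h1 := (isKEulerian_iff hl).1 h p.base q.base (lt_iff.1 hpq)
  rw [grade_eq p, grade_eq q]
  have h2 : ∑ z : Blowup r P with p < z ∧ z < q, (-1 : ℝ) ^ (grade ℕ z - grade ℕ p.base)
      = ∑ w ∈ (univ.filter fun z : P => p.base < z ∧ z < q.base) ×ˢ (univ : Finset (Fin r)),
        (-1 : ℝ) ^ (grade ℕ w.1 - grade ℕ p.base) := by
    refine sum_nbij' (fun z => (z.base, z.copy)) (fun w => mk w.1 w.2) ?_ ?_ ?_ ?_ ?_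
    · intro z hz
      simpa [lt_iff] using hz
    · intro z hz
      simpa [lt_iff, base_mk] using hz
    · intro z _
      exact mk_base_copy z
    · rintro ⟨z, e⟩ hz
      simp only [mem_product, mem_filter_univ, mem_univ, and_true] at hz
      exact Prod.ext rfl (copy_mk hz.1.ne_bot hz.2.ne_top e)
    · intro z _
      rfl
  rw [h2, sum_product]
  simp only [sum_const, card_univ, Fintype.card_fin, nsmul_eq_mul]
  rw [← mul_sum, h1, ← hr]
  ring

/-- Ranks in [1, n] exclude `⊥` and `⊤`, so a flag upstairs is a flag of P with an independent copy
index at each element of S. -/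
theorem flagVector_eq [Fintype P] [GradeMinOrder ℕ P] {n : ℕ} (hP : grade ℕ (⊤ : P) = n + 1)
    (S : Finset (Fin n)) :
    flagVector n (Blowup r P) S = (r : ℝ) ^ #S * flagVector n P S := by
  classical
  have hgr : ∀ (x : P) (i : Fin n), grade ℕ x = rk i → x ≠ ⊥ ∧ x ≠ ⊤ := by
    intro x i hx
    have := i.2
    simp only [rk] at hx
    constructor
    · rintro rfl
      simp at hx
    · rintro rfl
      omega
  have hcard : #(flags (Blowup r P) S) = #(flags P S ×ˢ (univ : Finset (S → Fin r))) := by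
    refine card_nbij' (fun c => (fun m => (c m).base, fun m => (c m).copy))
      (fun w m => if hm : m ∈ S then mk (w.1 m) (w.2 ⟨m, hm⟩) else ⊥) ?_ ?_ ?_ ?_
    · intro c hc
      simp only [mem_coe, mem_product, mem_univ, and_true, mem_flags] at hc ⊢
      refine ⟨hc.1, fun i hi j hj hij => lt_iff.1 (hc.2.1 i hi j hj hij), fun i hi => ?_⟩
      simp only [hc.2.2 i hi, base_bot]
    · rintro ⟨c, e⟩ hc
      simp only [mem_coe, mem_product, mem_univ, and_true, mem_flags] at hc ⊢
      refine ⟨fun i hi => ?_, fun i hi j hj hij => ?_, fun i hi => dif_neg hi⟩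
      · simp only [dif_pos hi]
        exact hc.1 i hi
      · simp only [dif_pos hi, dif_pos hj]
        rw [lt_iff, base_mk, base_mk]
        exact hc.2.1 i hi j hj hij
    · intro c hc
      simp only [mem_coe, mem_flags] at hc
      funext m
      by_cases hm : m ∈ S
      · simp only [dif_pos hm]
        exact mk_base_copy _
      · simp only [dif_neg hm]
        exact (hc.2.2 m hm).symm
    · rintro ⟨c, e⟩ hc
      simp only [mem_coe, mem_product, mem_univ, and_true, mem_flags] at hc
      refine Prod.ext (funext fun m => ?_) (funext fun m => ?_)
      · by_cases hm : m ∈ S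
        · simp only [dif_pos hm, base_mk]
        · simp only [dif_neg hm, base_bot]
          exact (hc.2.2 m hm).symm
      · have := hgr _ _ (hc.1 m.1 m.2)
        simp only [dif_pos m.2]
        exact copy_mk this.1 this.2 _
  rw [flagVector, flagVector, flagNumber_eq_card_flags, flagNumber_eq_card_flags, hcard,
    card_product]
  simp [mul_comm]

end Blowup
end FlagCone

namespace FlagCone
open Finset Filter Topology

/-! ### Interval posets -/

/-- Rank `i` of this poset consists of the functions from the set of those `t : ι` whose interval
`[lo t, hi t]` contains `i` to `Fin (N + 1)`, extended by `0`. -/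
def IntervalPoset {n : ℕ} {ι : Type} (lo hi : ι → Fin n) (N : ℕ) : Type :=
  {p : Fin (n + 2) × (ι → Fin (N + 1)) //
    ∀ t, ¬ (rk (lo t) ≤ p.1 ∧ p.1 ≤ rk (hi t)) → p.2 t = 0}

namespace IntervalPoset
variable {n : ℕ} {ι : Type} {lo hi : ι → Fin n} {N : ℕ}

/-- The rank of an element. -/
def level (p : IntervalPoset lo hi N) : ℕ := p.1.1

/-- The function underlying an element. -/
def label (p : IntervalPoset lo hi N) : ι → Fin (N + 1) := p.1.2

theorem label_eq_zero (p : IntervalPoset lo hi N) {t : ι}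
    (h : ¬ (rk (lo t) ≤ p.level ∧ p.level ≤ rk (hi t))) : p.label t = 0 := p.2 t h

theorem level_le (p : IntervalPoset lo hi N) : p.level ≤ n + 1 := by
  have := p.1.1.2
  simp only [level]
  omega

theorem ext {p q : IntervalPoset lo hi N} (h : p.level = q.level) (h' : p.label = q.label) :
    p = q :=
  Subtype.ext (Prod.ext (Fin.ext h) h')

open scoped Classical in
/-- The element of rank `i` obtained by restricting `g`. -/
noncomputable def mk (i : ℕ) (hi' : i ≤ n + 1) (g : ι → Fin (N + 1)) : IntervalPoset lo hi N :=
  ⟨(⟨i, by omega⟩, fun t => if rk (lo t) ≤ i ∧ i ≤ rk (hi t) then g t else 0),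
    fun t ht => if_neg ht⟩

theorem level_mk (i : ℕ) (hi' : i ≤ n + 1) (g : ι → Fin (N + 1)) :
    (mk i hi' g : IntervalPoset lo hi N).level = i := rfl

theorem label_mk {i : ℕ} (hi' : i ≤ n + 1) (g : ι → Fin (N + 1)) {t : ι} (h : rk (lo t) ≤ i)
    (h' : i ≤ rk (hi t)) : (mk i hi' g : IntervalPoset lo hi N).label t = g t :=
  if_pos ⟨h, h'⟩

/-- Elements of different ranks are comparable if they agree where both are defined. -/
def Below (p q : IntervalPoset lo hi N) : Prop :=
  p.level < q.level ∧ ∀ t, rk (lo t) ≤ p.level → q.level ≤ rk (hi t) → p.label t = q.label t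

/-- Transitivity needs the index sets to be intervals: a t defined at the ranks of p and s is also
defined at the rank of q between them. -/
theorem Below.trans {p q s : IntervalPoset lo hi N} (h : Below p q) (h' : Below q s) :
    Below p s :=
  ⟨h.1.trans h'.1, fun t ht ht' =>
    (h.2 t ht (h'.1.le.trans ht')).trans (h'.2 t (ht.trans h.1.le) ht')⟩

instance : PartialOrder (IntervalPoset lo hi N) where
  le p q := p = q ∨ Below p q
  le_refl p := Or.inl rfl
  le_trans p q s := by
    rintro (rfl | h) (rfl | h')
    exacts [Or.inl rfl, Or.inr h', Or.inr h, Or.inr (h.trans h')]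
  le_antisymm p q := by
    rintro (rfl | h) (h' | h')
    exacts [rfl, rfl, h'.symm, absurd (h.trans h').1 (lt_irrefl _)]

theorem le_iff {p q : IntervalPoset lo hi N} : p ≤ q ↔ p = q ∨ Below p q := Iff.rfl

theorem lt_iff {p q : IntervalPoset lo hi N} : p < q ↔ Below p q := by
  rw [lt_iff_le_and_ne, le_iff]
  constructor
  · rintro ⟨rfl | h, h'⟩
    exacts [absurd rfl h', h]
  · intro h
    refine ⟨Or.inr h, ?_⟩
    rintro rfl
    exact lt_irrefl _ h.1

theorem eq_mk_of_level {p : IntervalPoset lo hi N} {i : ℕ} (h : p.level = i) (hi' : i ≤ n + 1)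
    {g : ι → Fin (N + 1)} (hg : ∀ t, rk (lo t) ≤ i → i ≤ rk (hi t) → p.label t = g t) :
    p = mk i hi' g := by
  refine ext h (funext fun t => ?_)
  by_cases ht : rk (lo t) ≤ i ∧ i ≤ rk (hi t)
  · rw [label_mk _ _ ht.1 ht.2, hg t ht.1 ht.2]
  · rw [label_eq_zero p (by rwa [h]), label_eq_zero _ (by rwa [level_mk])]

noncomputable instance : BoundedOrder (IntervalPoset lo hi N) where
  top := mk (n + 1) le_rfl 0
  le_top p := by
    rcases p.level_le.eq_or_lt with h | h
    · refine Or.inl (eq_mk_of_level h _ fun t _ ht => absurd ht ?_)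
      have := (hi t).2
      simp only [rk]; omega
    · refine Or.inr ⟨h, fun t _ ht => absurd ht ?_⟩
      have := (hi t).2
      simp only [rk, level_mk]; omega
  bot := mk 0 (Nat.zero_le _) 0
  bot_le p := by
    rcases (Nat.zero_le p.level).eq_or_lt with h | h
    · exact Or.inl (eq_mk_of_level h.symm _ fun t ht _ => absurd ht (by simp [rk])).symm
    · exact Or.inr ⟨h, fun t ht _ => absurd ht (by simp [rk, level_mk])⟩

theorem level_eq_of_covBy {p q : IntervalPoset lo hi N} (h : p ⋖ q) : q.level = p.level + 1 := by
  have hlt := lt_iff.1 h.1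
  by_contra hne
  have hlt' : p.level + 1 < q.level := by have := hlt.1; omega
  classical
  -- Interpolate one rank above p, taking labels from p where its rank is not below the interval and
  -- from q elsewhere; the two agree where both matter.
  refine h.2 (c := mk (p.level + 1) (by have := q.level_le; omega)
    (fun t => if rk (lo t) ≤ p.level then p.label t else q.label t)) ?_ ?_
  · rw [lt_iff]
    refine ⟨by rw [level_mk]; omega, fun t ht ht' => ?_⟩
    rw [level_mk] at ht'
    rw [label_mk _ _ (by omega) ht', if_pos ht]
  · rw [lt_iff]
    refine ⟨by rw [level_mk]; omega, fun t ht ht' => ?_⟩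
    rw [level_mk] at ht
    rw [label_mk _ _ ht (by omega)]
    split_ifs with hc
    · exact hlt.2 t hc ht'
    · rfl

noncomputable instance : GradeMinOrder ℕ (IntervalPoset lo hi N) where
  grade := level
  grade_strictMono p q h := (lt_iff.1 h).1
  covBy_grade p q h := by
    rw [Nat.covBy_iff_add_one_eq, level_eq_of_covBy h]
  isMin_grade p h := by
    have : p = ⊥ := isMin_iff_eq_bot.1 h
    subst this
    exact isMin_bot

theorem grade_eq (p : IntervalPoset lo hi N) : grade ℕ p = p.level := rfl

noncomputable instance [Fintype ι] : Fintype (IntervalPoset lo hi N) := by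
  classical
  unfold IntervalPoset
  infer_instance

-- Along a flag the label at t is constant on the ranks where it is defined, so a flag is one free
-- choice among N + 1 values for each interval that meets S.
open scoped Classical in
theorem card_flags [Fintype ι] (S : Finset (Fin n)) :
    #(flags (IntervalPoset lo hi N) S)
      = (N + 1) ^ #{t | ∃ i ∈ S, lo t ≤ i ∧ i ≤ hi t} := by
  have hrk : ∀ i j : Fin n, rk i ≤ rk j ↔ i ≤ j := fun i j => by
    simp only [rk, Fin.le_def]; omega
  have hrkn : ∀ i : Fin n, rk i ≤ n + 1 := fun i => by
    have := i.2; simp only [rk]; omega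
  have hkey : ∀ c ∈ flags (IntervalPoset lo hi N) S, ∀ t, ∀ i ∈ S, ∀ j ∈ S,
      lo t ≤ i → i ≤ hi t → lo t ≤ j → j ≤ hi t → (c i).label t = (c j).label t := by
    intro c hc t
    rw [mem_flags] at hc
    have hlt : ∀ i ∈ S, ∀ j ∈ S, i < j → lo t ≤ i → j ≤ hi t →
        (c i).label t = (c j).label t := by
      intro i hi' j hj hij h1 h2
      refine (lt_iff.1 (hc.2.1 i hi' j hj hij)).2 t ?_ ?_
      · rw [← grade_eq, hc.1 i hi', hrk]; exact h1
      · rw [← grade_eq, hc.1 j hj, hrk]; exact h2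
    intro i hi' j hj h1 h2 h3 h4
    rcases lt_trichotomy i j with h | rfl | h
    · exact hlt i hi' j hj h h1 h4
    · rfl
    · exact (hlt j hj i hi' h h3 h2).symm
  have hcard : #(flags (IntervalPoset lo hi N) S) = #(Fintype.piFinset fun t : ι =>
      if ∃ i ∈ S, lo t ≤ i ∧ i ≤ hi t then (univ : Finset (Fin (N + 1))) else {0}) := by
    refine card_nbij'
      (fun c t => if h : ∃ i ∈ S, lo t ≤ i ∧ i ≤ hi t then (c h.choose).label t else 0)
      (fun g m => if m ∈ S then mk (rk m) (hrkn m) g else ⊥) ?_ ?_ ?_ ?_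
    · intro c _
      rw [mem_coe, Fintype.mem_piFinset]
      intro t
      by_cases h : ∃ i ∈ S, lo t ≤ i ∧ i ≤ hi t
      · simp [if_pos h]
      · simp [dif_neg h, if_neg h]
    · intro g _
      rw [mem_coe, mem_flags]
      refine ⟨fun i hi' => ?_, fun i hi' j hj hij => ?_, fun i hi' => by simp [hi']⟩
      · simp only [if_pos hi']
        rw [grade_eq, level_mk]
      · simp only [if_pos hi', if_pos hj]
        rw [lt_iff]
        have hij' : rk i < rk j := by simpa [rk] using hij
        refine ⟨by rw [level_mk, level_mk]; exact hij', fun t ht ht' => ?_⟩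
        rw [level_mk] at ht ht'
        rw [label_mk _ _ ht (by omega), label_mk _ _ (by omega) ht']
    · intro c hc
      have hc' := mem_flags.1 hc
      funext m
      by_cases hm : m ∈ S
      · simp only [if_pos hm]
        refine (eq_mk_of_level (hc'.1 m hm) _ fun t ht ht' => ?_).symm
        rw [hrk] at ht ht'
        have h : ∃ i ∈ S, lo t ≤ i ∧ i ≤ hi t := ⟨m, hm, ht, ht'⟩
        rw [dif_pos h]
        exact hkey c hc t m hm _ h.choose_spec.1 ht ht' h.choose_spec.2.1 h.choose_spec.2.2
      · simp only [if_neg hm]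
        exact (hc'.2.2 m hm).symm
    · intro g hg
      rw [mem_coe, Fintype.mem_piFinset] at hg
      funext t
      by_cases h : ∃ i ∈ S, lo t ≤ i ∧ i ≤ hi t
      · simp only [dif_pos h, if_pos h.choose_spec.1]
        exact label_mk _ _ ((hrk _ _).2 h.choose_spec.2.1) ((hrk _ _).2 h.choose_spec.2.2)
      · simp only [dif_neg h]
        have := hg t
        rw [if_neg h, mem_singleton] at this
        exact this.symm
  rw [hcard, Fintype.card_piFinset, ← prod_filter_mul_prod_filter_not univ
    (fun t => ∃ i ∈ S, lo t ≤ i ∧ i ≤ hi t), prod_congr rfl (g := fun _ => N + 1),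
    prod_const, prod_eq_one, mul_one]
  · intro t ht
    rw [if_neg (by simpa using ht), card_singleton]
  · intro t ht
    rw [if_pos (by simpa using ht), card_univ, Fintype.card_fin]

end IntervalPoset

/-! ### Closed cones and limits of interval posets -/

theorem isThick_one (P : Type*) [PartialOrder P] [Finite P] : IsThick 1 P := by
  intro x y h
  exact (Set.ncard_pos (Set.toFinite _)).2 h

theorem subset_closedCone {n : ℕ} (V : Set (FlagSpace n)) : V ⊆ closedCone V :=
  fun _ hv => subset_closure (Submodule.subset_span hv)

theorem isClosed_closedCone {n : ℕ} (V : Set (FlagSpace n)) :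
    IsClosed (closedCone V : Set (FlagSpace n)) := isClosed_closure

theorem closedCone_subset {n : ℕ} {V : Set (FlagSpace n)} {K : PointedCone ℝ (FlagSpace n)}
    (hK : IsClosed (K : Set (FlagSpace n))) (h : V ⊆ K) :
    (closedCone V : Set (FlagSpace n)) ⊆ K :=
  closure_minimal (Submodule.span_le.2 h) hK

open scoped Classical in
/-- The indicator vector of the sets that meet all intervals of a finite family lies in the closed
cone of the flag vectors of graded posets. -/
theorem indicator_mem_thickCone {n : ℕ} {ι : Type} [Fintype ι] (lo hi : ι → Fin n) :
    (fun S => if ∀ t, ∃ i ∈ S, lo t ≤ i ∧ i ≤ hi t then 1 else 0 : FlagSpace n)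
      ∈ thickCone 1 n := by
  have hmem : ∀ N : ℕ, ((1 / ((N : ℝ) + 1)) ^ Fintype.card ι) •
      flagVector n (IntervalPoset lo hi N) ∈ thickCone 1 n := by
    intro N
    refine Submodule.smul_mem (thickCone 1 n)
      (⟨(1 / ((N : ℝ) + 1)) ^ Fintype.card ι, by positivity⟩ : {c : ℝ // 0 ≤ c}) ?_
    exact subset_closedCone _ ⟨IntervalPoset lo hi N, inferInstance, inferInstance, inferInstance,
      inferInstance, rfl, isThick_one _, rfl⟩
  refine (isClosed_closedCone (thickFlagVectors 1 n)).mem_of_tendsto (b := atTop) ?_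
    (Eventually.of_forall hmem)
  rw [tendsto_pi_nhds]
  intro S
  -- After normalization the exponent counts the intervals missed by S, so the limit is 1 if there
  -- are none and 0 otherwise.
  have hval : ∀ N : ℕ, (((1 / ((N : ℝ) + 1)) ^ Fintype.card ι) •
      flagVector n (IntervalPoset lo hi N)) S
      = (1 / ((N : ℝ) + 1)) ^ #{t | ¬ ∃ i ∈ S, lo t ≤ i ∧ i ≤ hi t} := by
    intro N
    rw [Pi.smul_apply, flagVector, flagNumber_eq_card_flags, IntervalPoset.card_flags, smul_eq_mul,
      ← card_univ, ← card_filter_add_card_filter_not (s := (univ : Finset ι))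
        (fun t => ∃ i ∈ S, lo t ≤ i ∧ i ≤ hi t), pow_add]
    push_cast
    rw [mul_right_comm, ← mul_pow, one_div_mul_cancel (by positivity), one_pow, one_mul]
  simp only [hval]
  split_ifs with h
  · rw [filter_false_of_mem fun t _ => not_not.2 (h t)]
    simp
  · have hne : #{t | ¬ ∃ i ∈ S, lo t ≤ i ∧ i ≤ hi t} ≠ 0 := by
      rw [not_forall] at h
      obtain ⟨t, ht⟩ := h
      exact card_ne_zero_of_mem (a := t) (by simpa using ht)
    have := (tendsto_one_div_add_atTop_nhds_zero_nat (𝕜 := ℝ)).pow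
      #{t | ¬ ∃ i ∈ S, lo t ≤ i ∧ i ≤ hi t}
    rwa [zero_pow hne] at this
end FlagCone

namespace FlagCone
open Finset

/-! ### Flag vectors of thick posets -/

open scoped Classical in
/-- The first `r` elements of a finite set, in an enumeration of the ambient type. -/
noncomputable def firsts {α : Type*} [Fintype α] (r : ℕ) (X : Finset α) : Finset α :=
  {z ∈ X | #{w ∈ X | Fintype.equivFin α w < Fintype.equivFin α z} < r}

/-- Shrinking the set can only move z forward. This monotonicity, which needs one fixed enumeration
for all sets, is what makes goodness expressible through bad intervals. -/
theorem mem_firsts_of_subset {α : Type*} [Fintype α] {r : ℕ} {X Y : Finset α} (h : Y ⊆ X) {z : α}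
    (hz : z ∈ firsts r X) (hzY : z ∈ Y) : z ∈ firsts r Y := by
  classical
  simp only [firsts, mem_filter] at hz ⊢
  exact ⟨hzY, (card_le_card (filter_subset_filter _ h)).trans_lt hz.2⟩

theorem card_firsts {α : Type*} [Fintype α] {r : ℕ} {X : Finset α} (h : r ≤ #X) :
    #(firsts r X) = r := by
  classical
  let f : α → ℕ := fun z => #{w ∈ X | Fintype.equivFin α w < Fintype.equivFin α z}
  have hlt : ∀ y ∈ X, ∀ z, Fintype.equivFin α y < Fintype.equivFin α z → f y < f z := by
    intro y hy z hyz
    refine card_lt_card (Finset.ssubset_iff_subset_ne.2 ⟨fun w hw => ?_, fun heq => ?_⟩)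
    · rw [mem_filter] at hw ⊢
      exact ⟨hw.1, hw.2.trans hyz⟩
    · have : y ∈ X.filter fun w => Fintype.equivFin α w < Fintype.equivFin α z :=
        mem_filter.2 ⟨hy, hyz⟩
      rw [← heq, mem_filter] at this
      exact this.2.false
  have hinj : Set.InjOn f X := by
    intro y hy z hz hyz
    rcases lt_trichotomy (Fintype.equivFin α y) (Fintype.equivFin α z) with h' | h' | h'
    · exact absurd hyz (hlt y hy z h').ne
    · exact (Fintype.equivFin α).injective h'
    · exact absurd hyz (hlt z hz y h').ne'
  have himage : X.image f = range #X := by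
    refine eq_of_subset_of_card_le (fun i hi => ?_) ?_
    · obtain ⟨z, hz, rfl⟩ := mem_image.1 hi
      rw [mem_range]
      refine card_lt_card (filter_ssubset.2 ⟨z, hz, lt_irrefl _⟩)
    · rw [card_range, card_image_of_injOn hinj]
  have h1 : (firsts r X).image f = range r := by
    ext i
    rw [mem_image, mem_range]
    constructor
    · rintro ⟨z, hz, rfl⟩
      exact (mem_filter.1 hz).2
    · intro hi
      have : i ∈ X.image f := by rw [himage, mem_range]; omega
      obtain ⟨z, hz, rfl⟩ := mem_image.1 this
      exact ⟨z, mem_filter.2 ⟨hz, hi⟩, rfl⟩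
  rw [← card_image_of_injOn (s := firsts r X) (hinj.mono fun z hz => (mem_filter.1 hz).1), h1, card_range]

/-! ### Completing flags from the bottom up -/

variable {n : ℕ} {P : Type*} [PartialOrder P] [Fintype P] [GradeMinOrder ℕ P]

/-- Enlarge `S` by all indices less than `j`. -/
def fillBelow (S : Finset (Fin n)) (j : ℕ) : Finset (Fin n) := S ∪ univ.filter fun m => (m : ℕ) < j

theorem mem_fillBelow {S : Finset (Fin n)} {j : ℕ} {m : Fin n} :
    m ∈ fillBelow S j ↔ m ∈ S ∨ (m : ℕ) < j := by
  simp [fillBelow]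

theorem fillers_congr [OrderBot P] {S : Finset (Fin n)} {c d : Fin n → P} {j : Fin n}
    (h : ∀ m ∈ S, m ≠ j → c m = d m) : fillers S c j = fillers S d j := by
  ext z
  rw [mem_fillers, mem_fillers]
  refine and_congr_right fun _ => forall₂_congr fun m hm => ?_
  rcases eq_or_ne m j with rfl | hne
  · simp
  · rw [h m hm hne]

/-- As all lower ranks are occupied, the gap starts at j. A rank-2 interval at the bottom of the gap
has all its middle elements of rank `rk j`, and thickness supplies r of them. -/
theorem IsThick.le_card_fillers [BoundedOrder P] (hP : grade ℕ (⊤ : P) = n + 1) {r : ℕ}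
    (hr : IsThick r P) {T : Finset (Fin n)} {c : Fin n → P} (hc : IsFlag T c) {j : Fin n}
    (hj : j ∉ T) (hT : ∀ m < j, m ∈ T) : r ≤ #(fillers T c j) := by
  classical
  obtain ⟨l, hl, hlmax⟩ := Finset.exists_max_image
    (univ.filter fun l : Fin n => j ≤ l ∧ Disjoint (Icc j l) T) id ⟨j, by simp [hj]⟩
  rw [mem_filter_univ] at hl
  have hgap : IsMaxGap T j l := by
    refine ⟨hl.1, hl.2, fun i' l' hi' hl' hd => ?_⟩
    have hij : i' = j := by
      by_contra hne
      exact Finset.disjoint_left.1 hd (mem_Icc.2 ⟨le_rfl, (hi'.trans hl.1).trans hl'⟩)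
        (hT i' (lt_of_le_of_ne hi' hne))
    subst hij
    exact ⟨rfl, le_antisymm (hlmax l' ((mem_filter_univ _).2 ⟨hl.1.trans hl', hd⟩)) hl'⟩
  obtain ⟨x, y, hxy, hx, hy, hz⟩ := hc.exists_gap_ends hP hgap
  have hjl := Fin.le_def.1 hl.1
  obtain ⟨z, w, hxz, hzw, hwy⟩ := exists_covBy_covBy hxy (by omega)
  have hgw := grade_eq_of_covBy hzw
  have hgz := grade_eq_of_covBy hxz
  refine (hr x w ⟨z, hxz.lt, hzw.lt⟩).trans ?_
  rw [← Set.ncard_coe_finset]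
  refine Set.ncard_le_ncard (fun u hu => ?_) (Set.toFinite _)
  have h1 := grade_lt hu.1
  have h2 := grade_lt hu.2
  exact (hz j (mem_Icc.2 ⟨le_rfl, hl.1⟩) u (by simp only [rk]; omega)).2
    ⟨hu.1, hu.2.trans_le hwy⟩

open scoped Classical in
/-- Flags with rank set `fillBelow S j` in which each element of rank outside `S` is one of the
first `r` elements that fit between the elements before it and those at `S` after it. -/
noncomputable def goodFlags (P : Type*) [PartialOrder P] [OrderBot P] [Fintype P]
    [GradeMinOrder ℕ P] (r : ℕ) (S : Finset (Fin n)) (j : ℕ) : Finset (Fin n → P) :=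
  {c ∈ flags P (fillBelow S j) | ∀ a : Fin n, (a : ℕ) < j → a ∉ S →
    c a ∈ firsts r (fillers (fillBelow S a) c a)}

theorem mem_goodFlags [OrderBot P] {r : ℕ} {S : Finset (Fin n)} {j : ℕ} {c : Fin n → P} :
    c ∈ goodFlags P r S j ↔ IsFlag (fillBelow S j) c ∧ ∀ a : Fin n, (a : ℕ) < j → a ∉ S →
      c a ∈ firsts r (fillers (fillBelow S a) c a) := by
  simp only [goodFlags, mem_filter, mem_flags]

/-- Proceed rank by rank: a rank in S is already filled, and a rank outside S offers at least r
fillers, of which exactly the first r are permitted. -/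
theorem IsThick.card_goodFlags [BoundedOrder P] (hP : grade ℕ (⊤ : P) = n + 1) {r : ℕ}
    (hr : IsThick r P) (S : Finset (Fin n)) {j : ℕ} (hj : j ≤ n) :
    #(goodFlags P r S j) = r ^ #{a : Fin n | (a : ℕ) < j ∧ a ∉ S} * #(flags P S) := by
  classical
  induction j with
  | zero =>
    have h0 : goodFlags P r S 0 = flags P S := by
      ext c
      rw [mem_goodFlags, mem_flags]
      simp [fillBelow]
    rw [h0]
    simp
  | succ j ih =>
    let i : Fin n := ⟨j, hj⟩
    by_cases hi : i ∈ S
    · have hlt : ∀ a : Fin n, a ∉ S → ((a : ℕ) < j + 1 ↔ (a : ℕ) < j) := by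
        intro a ha
        have : a ≠ i := by rintro rfl; exact ha hi
        have : (a : ℕ) ≠ j := fun h => this (Fin.ext h)
        omega
      have hfill : fillBelow S (j + 1) = fillBelow S j := by
        ext a
        rw [mem_fillBelow, mem_fillBelow]
        by_cases ha : a ∈ S
        · simp [ha]
        · rw [hlt a ha]
      have hgood : goodFlags P r S (j + 1) = goodFlags P r S j := by
        ext c
        rw [mem_goodFlags, mem_goodFlags, hfill]
        refine and_congr_right fun _ => forall_congr' fun a => ?_
        by_cases ha : a ∈ S
        · simp [ha]
        · rw [hlt a ha]
      rw [hgood, ih (by omega)]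
      congr 3
      ext a
      simp only [mem_filter_univ]
      exact and_congr_left fun ha => (hlt a ha).symm
    · have hiT : i ∉ fillBelow S j := by
        rw [mem_fillBelow]
        simp [hi, i]
      have hfill : fillBelow S (j + 1) = insert i (fillBelow S j) := by
        ext a
        rw [mem_insert, mem_fillBelow, mem_fillBelow, Fin.ext_iff]
        simp only [i]
        constructor
        · rintro (h | h)
          · exact Or.inr (Or.inl h)
          · omega
        · rintro (h | h | h)
          exacts [Or.inr (by omega), Or.inl h, Or.inr (by omega)]
      -- The condition at a ≤ j ignores the new element at i, because i lies neither in S nor below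
      -- a. So erasing it preserves the earlier choices.
      have hcongr : ∀ (c : Fin n → P) (a : Fin n), (a : ℕ) ≤ j →
          fillers (fillBelow S a) (Function.update c i ⊥) a = fillers (fillBelow S a) c a := by
        intro c a ha
        refine fillers_congr fun m hm _ => Function.update_of_ne ?_ _ _
        rintro rfl
        rw [mem_fillBelow] at hm
        rcases hm with hm | hm
        · exact hi hm
        · simp only [i] at hm; omega
      rw [card_insert_flags hiT (goodFlags P r S j) (goodFlags P r S (j + 1))
        (fun c => firsts r (fillers (fillBelow S j) c i)) (fun c hc => (mem_goodFlags.1 hc).1)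
        (fun c => ?_), sum_congr rfl (g := fun _ => r), sum_const, ih (by omega), smul_eq_mul]
      · have hset : (univ.filter fun a : Fin n => (a : ℕ) < j + 1 ∧ a ∉ S)
            = insert i (univ.filter fun a : Fin n => (a : ℕ) < j ∧ a ∉ S) := by
          ext a
          simp only [mem_insert, mem_filter_univ]
          constructor
          · rintro ⟨h, h'⟩
            rcases eq_or_ne a i with h'' | h''
            · exact Or.inl h''
            · have : (a : ℕ) ≠ j := fun h => h'' (Fin.ext h)
              exact Or.inr ⟨by omega, h'⟩
          · rintro (rfl | h)
            · exact ⟨by simp [i], hi⟩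
            · exact ⟨by omega, h.2⟩
        rw [hset, card_insert_of_notMem (by simp [i])]
        ring
      · intro c hc
        refine card_firsts (hr.le_card_fillers hP (mem_goodFlags.1 hc).1 hiT fun m hm => ?_)
        rw [mem_fillBelow]
        exact Or.inr (Fin.lt_def.1 hm)
      · have hci : fillers (fillBelow S j) (Function.update c i ⊥) i
            = fillers (fillBelow S j) c i := hcongr c i le_rfl
        simp only [mem_goodFlags, hfill]
        rw [hci]
        constructor
        · rintro ⟨h1, h2⟩
          refine ⟨⟨(h1.erase hiT).1, fun a ha haS => ?_⟩, h2 i (by simp [i]) hi⟩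
          rw [hcongr c a ha.le, Function.update_of_ne]
          · exact h2 a (by omega) haS
          · rintro rfl
            simp [i] at ha
        · rintro ⟨⟨h1, h2⟩, h3⟩
          refine ⟨?_, fun a ha haS => ?_⟩
          · have := h1.update hiT (z := c i) (by rw [hci]; exact (mem_filter.1 h3).1)
            simpa using this
          · rcases eq_or_ne a i with rfl | hne
            · exact h3
            · have : (a : ℕ) ≠ j := fun h => hne (Fin.ext h)
              have := h2 a (by omega) haS
              rwa [hcongr c a (by omega), Function.update_of_ne hne] at this

/-- For a maximal flag `c`, the pairs `(a, b)` such that `c a` is not among the first `r` elements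
that fit between the elements before `a` and those after `b`. -/
def IsBad [OrderBot P] (r : ℕ) (c : Fin n → P) (p : Fin n × Fin n) : Prop :=
  p.1 ≤ p.2 ∧ c p.1 ∉ firsts r (fillers {m | m < p.1 ∨ p.2 < m} c p.1)

theorem IsFlag.mem_fillers_self [OrderBot P] {c : Fin n → P} (hc : IsFlag univ c)
    (S : Finset (Fin n)) (a : Fin n) : c a ∈ fillers S c a :=
  mem_fillers.2 ⟨hc.1 a (mem_univ _), fun m _ => ⟨fun h => hc.2.1 m (mem_univ _) a (mem_univ _) h,
    fun h => hc.2.1 a (mem_univ _) m (mem_univ _) h⟩⟩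

/-- If S misses [a, b], constraining by all ranks beyond b leaves no more fillers than constraining
by S, so a good choice at a stays among the first r. For the largest such b the two filler sets
coincide, which gives the converse. -/
theorem mem_goodFlags_iff [OrderBot P] {r : ℕ} {S : Finset (Fin n)} {c : Fin n → P} :
    c ∈ goodFlags P r S n ↔
      c ∈ flags P univ ∧ ∀ p, IsBad r c p → ∃ i ∈ S, p.1 ≤ i ∧ i ≤ p.2 := by
  classical
  have huniv : fillBelow S n = univ := by
    ext a
    simp [mem_fillBelow]
  rw [mem_goodFlags, mem_flags, huniv]
  refine and_congr_right fun hc => ⟨fun h => ?_, fun h a _ haS => ?_⟩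
  · rintro ⟨a, b⟩ ⟨hab, hbad⟩
    by_contra! hS
    refine hbad (mem_firsts_of_subset (fun z hz => ?_)
      (h a a.2 fun haS => (hS a haS le_rfl).not_ge hab) (hc.mem_fillers_self _ _))
    rw [mem_fillers] at hz ⊢
    refine ⟨hz.1, fun m hm => ⟨fun hma => (hz.2 m (by simp [hma])).1 hma, fun ham => ?_⟩⟩
    rw [mem_fillBelow] at hm
    rcases hm with hm | hm
    · exact (hz.2 m (by simp [hS m hm ham.le])).2 ham
    · exact absurd (Fin.lt_def.1 ham) (by omega)
  · obtain ⟨b, hb, hbmax⟩ := Finset.exists_max_image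
      (univ.filter fun b : Fin n => a ≤ b ∧ ∀ i ∈ S, ¬ (a ≤ i ∧ i ≤ b)) id
      ⟨a, by
        rw [mem_filter_univ]
        refine ⟨le_rfl, fun i hi h => haS ?_⟩
        rwa [le_antisymm h.1 h.2]⟩
    rw [mem_filter_univ] at hb
    have hgood : c a ∈ firsts r (fillers ({m | m < a ∨ b < m} : Finset (Fin n)) c a) := by
      by_contra hcon
      obtain ⟨i, hi, hai⟩ := h (a, b) ⟨hb.1, hcon⟩
      exact hb.2 i hi hai
    refine mem_firsts_of_subset (fun z hz => ?_) hgood (hc.mem_fillers_self _ _)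
    rw [mem_fillers] at hz ⊢
    refine ⟨hz.1, fun m hm => ⟨fun hma => ?_, fun ham => ?_⟩⟩
    · exact (hz.2 m (mem_fillBelow.2 (Or.inr (Fin.lt_def.1 hma)))).1 hma
    · rw [mem_filter_univ] at hm
      have hbm : b < m := hm.resolve_left ham.not_gt
      have hlt := Fin.lt_def.1 hbm
      let b' : Fin n := ⟨b + 1, by have := m.2; omega⟩
      have hbb' : b < b' := Fin.lt_def.2 (by simp [b'])
      -- By maximality of b its successor lies in S, and the flag element there bounds z below every
      -- later element of c.
      have hb'S : b' ∈ S := by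
        by_contra hb'
        refine hbb'.not_ge (hbmax b' ?_)
        rw [mem_filter_univ]
        refine ⟨hb.1.trans hbb'.le, fun i hi hai => hb.2 i hi ⟨hai.1, ?_⟩⟩
        have hne : i ≠ b' := by rintro rfl; exact hb' hi
        have : (i : ℕ) ≠ b' := fun h => hne (Fin.ext h)
        have := Fin.le_def.1 hai.2
        rw [Fin.le_def]
        simp only [b'] at *
        omega
      refine ((hz.2 b' (mem_fillBelow.2 (Or.inl hb'S))).2 (hb.1.trans_lt hbb')).trans_le ?_
      rcases eq_or_ne b' m with hbm' | hne
      · rw [hbm']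
      · refine (hc.2.1 b' (mem_univ _) m (mem_univ _) (lt_of_le_of_ne ?_ hne)).le
        rw [Fin.le_def]
        exact hlt

/-- The linear map multiplying the coordinate indexed by `S` by `t ^ #S`. -/
def scale (n : ℕ) (t : ℝ) : FlagSpace n →ₗ[ℝ] FlagSpace n where
  toFun x S := t ^ #S * x S
  map_add' x y := by ext S; simp [mul_add]
  map_smul' a x := by ext S; simp [mul_left_comm]

theorem scale_apply (t : ℝ) (x : FlagSpace n) (S : Finset (Fin n)) :
    scale n t x S = t ^ #S * x S := rfl

theorem scale_scale_inv {t : ℝ} (ht : t ≠ 0) (x : FlagSpace n) : scale n t (scale n t⁻¹ x) = x := by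
  ext S
  rw [scale_apply, scale_apply, ← mul_assoc, ← mul_pow, mul_inv_cancel₀ ht, one_pow, one_mul]

theorem continuous_scale (n : ℕ) (t : ℝ) : Continuous (scale n t) :=
  continuous_pi fun S => continuous_const.mul (continuous_apply S)

/-- The scaled flag vector of an `r`-thick poset lies in the closed cone of the flag vectors of
graded posets. -/
theorem IsThick.scale_flagVector_mem [BoundedOrder P] (hP : grade ℕ (⊤ : P) = n + 1) {r : ℕ}
    (hr0 : r ≠ 0) (hr : IsThick r P) :
    scale n (r : ℝ)⁻¹ (flagVector n P) ∈ thickCone 1 n := by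
  classical
  have hr0' : (r : ℝ) ≠ 0 := Nat.cast_ne_zero.2 hr0
  -- Count the good maximal flags for S in two ways: as r^(n-|S|) f_S, and as a sum over maximal
  -- flags of the indicator that S meets all their bad intervals.
  have hsum : scale n (r : ℝ)⁻¹ (flagVector n P) = ((r : ℝ)⁻¹ ^ n) • ∑ c ∈ flags P univ,
      (fun S => if ∀ t : {p // IsBad r c p}, ∃ i ∈ S, t.1.1 ≤ i ∧ i ≤ t.1.2 then 1 else 0 :
        FlagSpace n) := by
    ext S
    have hcard : #{a : Fin n | (a : ℕ) < n ∧ a ∉ S} + #S = n := by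
      have : (univ.filter fun a : Fin n => (a : ℕ) < n ∧ a ∉ S) = Sᶜ := by
        ext a; simp
      rw [this, card_compl_add_card, Fintype.card_fin]
    have h1 := hr.card_goodFlags hP S le_rfl
    have h2 : goodFlags P r S n = (flags P univ).filter fun c =>
        ∀ t : {p // IsBad r c p}, ∃ i ∈ S, t.1.1 ≤ i ∧ i ≤ t.1.2 := by
      ext c
      rw [mem_goodFlags_iff, mem_filter, Subtype.forall]
    rw [Pi.smul_apply, Finset.sum_apply, sum_boole, ← h2, h1, scale_apply, flagVector,
      flagNumber_eq_card_flags, smul_eq_mul]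
    have h3 : (r : ℝ)⁻¹ ^ n = (r : ℝ)⁻¹ ^ #{a : Fin n | (a : ℕ) < n ∧ a ∉ S} * (r : ℝ)⁻¹ ^ #S := by
      rw [← pow_add, hcard]
    rw [h3]
    push_cast
    rw [inv_pow, inv_pow]
    field_simp
  rw [hsum]
  refine Submodule.smul_mem (thickCone 1 n)
    (⟨(r : ℝ)⁻¹ ^ n, by positivity⟩ : {c : ℝ // 0 ≤ c}) (Submodule.sum_mem _ fun c _ => ?_)
  exact indicator_mem_thickCone (ι := {p // IsBad r c p}) (fun t => t.1.1) (fun t => t.1.2)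
end FlagCone

/-! ### Transporting cones by scaling -/

namespace FlagCone
open Finset

theorem closedCone_subset_comap_scale {n : ℕ} {V W : Set (FlagSpace n)} {t : ℝ}
    (h : ∀ v ∈ V, scale n t v ∈ closedCone W) {x : FlagSpace n} (hx : x ∈ closedCone V) :
    scale n t x ∈ closedCone W :=
  closedCone_subset (K := (closedCone W).comap (scale n t))
    ((isClosed_closedCone W).preimage (continuous_scale n t)) h hx

/-- The terms at S ∪ {j} carry one more factor t than the term at S, and the change of k compensates
for it. -/
theorem scale_mem_dehnSommerville {n : ℕ} {k l t : ℝ} (hkl : k = l * t) {x : FlagSpace n}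
    (hx : x ∈ dehnSommerville l n) : scale n t x ∈ dehnSommerville k n := by
  intro S i j h
  have h1 := hx S i j h
  rw [sum_congr rfl fun m hm => by
    rw [scale_apply, card_union_of_disjoint (disjoint_singleton_right.2
      (Finset.disjoint_left.1 h.2.1 hm)), card_singleton, mul_left_comm], ← mul_sum, scale_apply,
    hkl]
  linear_combination t ^ (#S + 1) * h1

theorem eulerianCone_subset {n : ℕ} {k : ℝ} (hk : k ≠ 0) {r : ℕ} (hr : 2 * k = r) :
    (eulerianCone k n : Set (FlagSpace n))
      ⊆ (thickCone r n : Set (FlagSpace n)) ∩ dehnSommerville k n := by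
  refine Set.subset_inter (closedCone_subset (isClosed_closedCone _) ?_)
    (closedCone_subset (K := (dehnSommerville k n).restrictScalars _)
      (dehnSommerville k n).closed_of_finiteDimensional ?_)
  · rintro v ⟨P, _, _, _, _, hP, hE, rfl⟩
    exact subset_closedCone _ ⟨P, inferInstance, inferInstance, inferInstance, inferInstance, hP,
      hE.isThick hk hr, rfl⟩
  · rintro v ⟨P, _, _, _, _, hP, hE, rfl⟩
    have := Fintype.ofFinite P
    exact hE.flagVector_mem_dehnSommerville hP hk

theorem scale_mem_eulerianCone {n : ℕ} {k l : ℝ} (hk : k ≠ 0) (hl : l ≠ 0) {r : ℕ}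
    (hr : l * r = k) {x : FlagSpace n} (hx : x ∈ eulerianCone l n) :
    scale n r x ∈ eulerianCone k n := by
  refine closedCone_subset_comap_scale ?_ hx
  rintro v ⟨P, _, _, _, _, hP, hE, rfl⟩
  have := Fintype.ofFinite P
  have : NeZero r := ⟨by rintro rfl; simp [eq_comm, hk] at hr⟩
  refine subset_closedCone _ ⟨Blowup r P, inferInstance, inferInstance, inferInstance,
    inferInstance, ?_, Blowup.isKEulerian hk hl hr hE, ?_⟩
  · rw [Blowup.grade_eq, Blowup.base_top, hP]
  · ext S
    rw [Blowup.flagVector_eq hP, scale_apply]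

theorem scale_mem_thickCone_one {n r : ℕ} (hr : r ≠ 0) {x : FlagSpace n} (hx : x ∈ thickCone r n) :
    scale n (r : ℝ)⁻¹ x ∈ thickCone 1 n := by
  refine closedCone_subset_comap_scale ?_ hx
  rintro v ⟨P, _, _, _, _, hP, hT, rfl⟩
  have := Fintype.ofFinite P
  exact hT.scale_flagVector_mem hP hr

end FlagCone

theorem mainTheorem5 (n : ℕ) (hn : 1 ≤ n)
    (hhalf : (FlagCone.eulerianCone (1 / 2) n : Set (FlagCone.FlagSpace n))
      = (FlagCone.thickCone 1 n : Set (FlagCone.FlagSpace n))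
        ∩ (FlagCone.dehnSommerville (1 / 2) n : Set (FlagCone.FlagSpace n)))
    (k : ℝ) (hk : 1 ≤ k) (r : ℕ) (hr : 2 * k = (r : ℝ)) :
    (FlagCone.eulerianCone k n : Set (FlagCone.FlagSpace n))
      = (FlagCone.thickCone r n : Set (FlagCone.FlagSpace n))
        ∩ (FlagCone.dehnSommerville k n : Set (FlagCone.FlagSpace n)) := by
  have hk0 : k ≠ 0 := by linarith
  have hr0' : (r : ℝ) ≠ 0 := by rw [← hr]; linarith
  have hr0 : r ≠ 0 := Nat.cast_ne_zero.1 hr0'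
  refine (FlagCone.eulerianCone_subset hk0 hr).antisymm ?_
  rintro x ⟨hx, hx'⟩
  -- Scale down by r = 2k to reach the half-Eulerian case, apply the assumption there, then scale
  -- back up by r.
  have hy : FlagCone.scale n (r : ℝ)⁻¹ x ∈ (FlagCone.eulerianCone (1 / 2) n : Set _) := by
    rw [hhalf]
    refine ⟨FlagCone.scale_mem_thickCone_one hr0 hx, FlagCone.scale_mem_dehnSommerville ?_ hx'⟩
    rw [← hr]
    field_simp
  rw [← FlagCone.scale_scale_inv hr0' x]
  exact FlagCone.scale_mem_eulerianCone hk0 (by norm_num) (by rw [← hr]; ring) hy
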